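/- Setting. Let $T$ be a locally compact metric space and let $\mathcal A$ be a nonempty family of compact subsets of $T$ such that: $\emptyset' := \bigcap_{A\in\mathcal A}A$ is nonempty; every intersection of a nonempty subfamily of $\mathcal A$ belongs to $\mathcal A$; and (Shape) whenever $A\subseteq A_1\cup\dots\cup A_k$ with $A,A_1,\dots,A_k\in\mathcal A$, there is an $i$ with $A\subseteq A_i$. Let $m$ be a measure on the $\sigma$-field $\sigma(\mathcal A)$, finite on compact sets (for instance a Radon measure), with $m(\emptyset')=0$ and $\lim_n m(A_n)=m\big(\overline{\bigcup_k A_k}\big)$ for every increasing sequence $(A_n)$ in $\mathcal A$ such that this closure belongs to $\sigma(\mathcal A)$. Let $\lambda,\sigma>0$. Increments. Let $\mathcal A(u)$ be the class of the unions of finitely many (at least one) members of $\mathcal A$. Let $C=A\setminus B$ with $A\in\mathcal A$, $B\in\mathcal A(u)$, $B\subseteq A$, and let $\{A_1,\dots,A_k\}$ be the extremal representation of $B$, that is $B=\bigcup_i A_i$, $A_i\in\mathcal A$, and $A_i\not\subseteq A_j$ for $i\ne j$. For $U$ in the semilattice $\mathcal A_\ell$ of all intersections $\bigcap_{j\in J}A_j$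 with $\emptyset\ne J\subseteq\{1,\dots,k\}$, let $$c_U=\sum_{\emptyset\ne J\subseteq\{1,\dots,k\},\ \bigcap_{j\in J}A_j=U}(-1)^{|J|+1}$$ be its coefficient in the inclusion-exclusion formula, and let $\mathcal A_C=\{U\in\mathcal A_\ell:\ U\not\subseteq B^\circ\text{ or }c_U\neq0\}$. (As long as the terms of the sets $U\subseteq B^\circ$ cancel in the inclusion-exclusion formula, $\mathcal A_C$ is the set of the $U\in\mathcal A_\ell$ with $U\not\subseteq B^\circ$.) Set-indexed Ornstein-Uhlenbeck process. Let $X=(X_U)_{U\in\mathcal A}$ be a real process, put $\mathbf X_C=(X_U)_{U\in\mathcal A_C}$ and $\mathcal F_B=\sigma(X_U:\ U\in\mathcal A,\ U\subseteq B)$, and let $\mathcal G^*_C$ be the $\sigma$-field generated by all $\mathcal F_{B'}$ with $B'\in\mathcal A(u)$, $B'\cap C=\emptyset$. The process $X$ is a set-indexed Ornstein-Uhlenbeck process with initial law $\nu$ and parameters $\lambda,\sigma$ if $X_{\emptyset'}\sim\nu$ and if, for all $C=A\setminus B$ as above and all Borel $f:\mathbb R\to\mathbb R_+$, almost surely $$\mathbb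 E[f(X_A)\mid\mathcal G^*_C]=\mathbb E[f(X_A)\mid\mathbf X_C]=\int f\,dP_C(\mathbf X_C;\cdot),$$ where $P_C(\mathbf x;\cdot)$ is the normal law (a Dirac mass if its variance is $0$) with mean and variance $$e^{-\lambda m(A)}\sum_{U\in\mathcal A_C}c_U\,x_U\,e^{\lambda m(U)},\qquad \sigma_C^2=\frac{\sigma^2}{2\lambda}\Big(1-e^{-2\lambda m(A)}\sum_{U\in\mathcal A_C}c_U\,e^{2\lambda m(U)}\Big).$$ Proposition. Let $x\in\mathbb R$ and let $\mathbb P_x$ be a probability measure on $\mathbb R^{\mathcal A}$ (with the product $\sigma$-field) under which the canonical process $X_U(\omega)=\omega(U)$ is a set-indexed Ornstein-Uhlenbeck process with initial law $\delta_x$ and parameters $\lambda,\sigma$. Then, under $\mathbb P_x$, $X$ is a Gaussian process (all its finite-dimensional laws are Gaussian, possibly degenerate), and for all $U,V\in\mathcal A$ $$\mathbb E_x[X_U]=x\,e^{-\lambda m(U)},\qquad \operatorname{Cov}_x(X_U,X_V)=\frac{\sigma^2}{2\lambda}\Big(e^{-\lambda m(U\triangle V)}-e^{-\lambda(m(U)+m(V))}\Big).$$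 -/

import Mathlib

open MeasureTheory ProbabilityTheory Filter Topology
open scoped NNReal ENNReal

noncomputable section

/-- An indexing collection: a family of compact subsets of `T` whose total intersection is nonempty,
closed under arbitrary (nonempty) intersections, and satisfying the Shape hypothesis. -/
structure IndexingCollection (T : Type*) [TopologicalSpace T] where
  /-- The family of sets. -/
  sets : Set (Set T)
  nonempty : sets.Nonempty
  isCompact : ∀ A ∈ sets, IsCompact A
  sInter_nonempty : (⋂₀ sets).Nonempty
  sInter_mem : ∀ S : Set (Set T), S ⊆ sets → S.Nonempty → ⋂₀ S ∈ sets
  /-- The Shape hypothesis. -/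
  shape : ∀ A ∈ sets, ∀ F : Finset (Set T), (∀ B ∈ F, B ∈ sets) → A ⊆ (⋃ B ∈ F, B) →
    ∃ B ∈ F, A ⊆ B

namespace IndexingCollection

variable {T : Type*} [TopologicalSpace T]

/-- The index set of the processes: the members of the collection, as a type. The order is
inclusion. -/
abbrev Index (𝒜 : IndexingCollection T) : Type _ := {A : Set T // A ∈ 𝒜.sets}

/-- The smallest member of the collection, that is the intersection of all its members. -/
def base (𝒜 : IndexingCollection T) : 𝒜.Index :=
  ⟨⋂₀ 𝒜.sets, 𝒜.sInter_mem 𝒜.sets (fun _ h => h) 𝒜.nonempty⟩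

/-- The σ-field generated by the collection. -/
abbrev sigmaField (𝒜 : IndexingCollection T) : MeasurableSpace T :=
  MeasurableSpace.generateFrom 𝒜.sets

/-- The standing assumptions on the measure `m`, defined on the σ-field generated by the collection:
it is finite on compact sets (as every Radon measure is), it vanishes on the smallest member of the
collection, and it is monotonically continuous. -/
structure IsAdmissible (𝒜 : IndexingCollection T) (m : @Measure T 𝒜.sigmaField) : Prop where
  lt_top : ∀ K : Set T, IsCompact K → MeasurableSet[𝒜.sigmaField] K → m K < ∞
  base_eq_zero : m (𝒜.base : Set T) = 0
  continuous : ∀ A : ℕ → 𝒜.Index, Monotone A →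
    MeasurableSet[𝒜.sigmaField] (closure (⋃ n, (A n : Set T))) →
    Tendsto (fun n => m (A n : Set T)) atTop (𝓝 (m (closure (⋃ n, (A n : Set T)))))

/-- The union of a finite family of members of the collection. -/
def union {𝒜 : IndexingCollection T} (E : Finset 𝒜.Index) : Set T := ⋃ V ∈ E, (V : Set T)

/-- The class of finite unions of members of the collection (at least one set in each union). -/
def finiteUnions (𝒜 : IndexingCollection T) : Set (Set T) :=
  {B | ∃ E : Finset 𝒜.Index, E.Nonempty ∧ B = union E}

/-- `E` is an extremal representation of the set `union E`: no member of `E` is contained in another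
one. -/
def IsExtremal {𝒜 : IndexingCollection T} (E : Finset 𝒜.Index) : Prop :=
  E.Nonempty ∧ ∀ V ∈ E, ∀ W ∈ E, V ≠ W → ¬ (V : Set T) ⊆ (W : Set T)

/-- The semilattice of all the intersections of members of `E`. -/
def semilattice {𝒜 : IndexingCollection T} (E : Finset 𝒜.Index) : Set 𝒜.Index :=
  {U | ∃ J : Finset 𝒜.Index, J ⊆ E ∧ J.Nonempty ∧ (U : Set T) = ⋂ V ∈ J, (V : Set T)}

lemma finite_semilattice {𝒜 : IndexingCollection T} (E : Finset 𝒜.Index) :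
    (semilattice E).Finite := by
  refine Set.Finite.of_finite_image (f := fun U : 𝒜.Index => (U : Set T)) ?_
    Subtype.val_injective.injOn
  refine Set.Finite.subset (E.powerset.finite_toSet.image
    (fun J : Finset 𝒜.Index => ⋂ V ∈ J, (V : Set T))) ?_
  rintro _ ⟨U, ⟨J, hJ, -, hU⟩, rfl⟩
  exact ⟨J, by simpa using hJ, hU.symm⟩

open scoped Classical in
/-- The (signed) coefficient of the term indexed by `U` in the inclusion-exclusion formula
`∑ V_i - ∑ V_i ∩ V_j + ⋯` over the members of `E`. -/
def coeff {𝒜 : IndexingCollection T} (E : Finset 𝒜.Index) (U : 𝒜.Index) : ℤ :=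
  ∑ J ∈ E.powerset.filter fun J : Finset 𝒜.Index =>
    J.Nonempty ∧ (⋂ V ∈ J, (V : Set T)) = (U : Set T), (-1) ^ (J.card + 1)

open scoped Classical in
/-- The sets at the border of `A \ B`, where `B = union E`: the members of the semilattice of `E`
that are not contained in the interior of `B`. A member `U` which is contained in the interior of
`B` is left out because its term in the inclusion-exclusion formula is cancelled by the others; it
is kept in the degenerate cases (such as `B` open) in which its term is not cancelled. -/
def frontier {𝒜 : IndexingCollection T} (E : Finset 𝒜.Index) : Finset 𝒜.Index :=
  (finite_semilattice E).toFinset.filter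
    fun U : 𝒜.Index => ¬ (U : Set T) ⊆ interior (union E) ∨ coeff E U ≠ 0

section SetIndexed

variable {Ω : Type*} [MeasurableSpace Ω]

/-- The natural filtration of `X`, at any subset `S` of `T`: the σ-field generated by the variables
`X V` for the members `V` of the collection contained in `S`. -/
abbrev naturalFiltration {𝒜 : IndexingCollection T} (X : 𝒜.Index → Ω → ℝ) (S : Set T) :
    MeasurableSpace Ω :=
  ⨆ (V : 𝒜.Index) (_ : (V : Set T) ⊆ S), MeasurableSpace.comap (X V) inferInstance

/-- The strong past of the increment `C`: generated by the σ-fields of the natural filtration at the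
finite unions of members of the collection which do not meet `C`. -/
abbrev strongPast {𝒜 : IndexingCollection T} (X : 𝒜.Index → Ω → ℝ) (C : Set T) :
    MeasurableSpace Ω :=
  ⨆ (B : Set T) (_ : B ∈ 𝒜.finiteUnions ∧ Disjoint B C), naturalFiltration X B

/-- The vector of the values of `X` at the border sets of an increment `A \ union E`. -/
def frontierVector {𝒜 : IndexingCollection T} (X : 𝒜.Index → Ω → ℝ) (E : Finset 𝒜.Index) (ω : Ω) :
    {U : 𝒜.Index // U ∈ frontier E} → ℝ :=
  fun U => X U ω

/-- `X` is `𝒞`-Markov under `P`, with transition system `Q`. An increment `C = A \ B`, with `A` in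
the collection and `B ⊆ A` a finite union of members of the collection, is given by `A` and by the
extremal representation `E` of `B`. -/
def IsCMarkov {𝒜 : IndexingCollection T} (X : 𝒜.Index → Ω → ℝ) (P : Measure Ω)
    (Q : 𝒜.Index → (E : Finset 𝒜.Index) → ({U : 𝒜.Index // U ∈ frontier E} → ℝ) → Measure ℝ) :
    Prop :=
  ∀ (A : 𝒜.Index) (E : Finset 𝒜.Index), IsExtremal E → union E ⊆ (A : Set T) →
    ∀ f : ℝ → ℝ≥0, Measurable f →
      condLExp (strongPast X ((A : Set T) \ union E)) P (fun ω => (f (X A ω) : ℝ≥0∞)) =ᵐ[P]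
        condLExp (MeasurableSpace.comap (frontierVector X E) inferInstance) P
          (fun ω => (f (X A ω) : ℝ≥0∞)) ∧
      condLExp (MeasurableSpace.comap (frontierVector X E) inferInstance) P
          (fun ω => (f (X A ω) : ℝ≥0∞)) =ᵐ[P]
        fun ω => ∫⁻ y, (f y : ℝ≥0∞) ∂(Q A E (frontierVector X E ω))

end SetIndexed

/-- The mean of the Ornstein-Uhlenbeck transition law of the increment `A \ union E`. -/
def ouMean {𝒜 : IndexingCollection T} (m : @Measure T 𝒜.sigmaField) (lam : ℝ) (A : 𝒜.Index)
    (E : Finset 𝒜.Index) (x : {U : 𝒜.Index // U ∈ frontier E} → ℝ) : ℝ :=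
  Real.exp (-lam * (m (A : Set T)).toReal) *
    ∑ U : {U : 𝒜.Index // U ∈ frontier E},
      (coeff E U : ℝ) * x U * Real.exp (lam * (m (U.1 : Set T)).toReal)

/-- The variance of the Ornstein-Uhlenbeck transition law of the increment `A \ union E`. -/
def ouVariance {𝒜 : IndexingCollection T} (m : @Measure T 𝒜.sigmaField) (lam sig : ℝ)
    (A : 𝒜.Index) (E : Finset 𝒜.Index) : ℝ :=
  sig ^ 2 / (2 * lam) *
    (1 - Real.exp (-2 * lam * (m (A : Set T)).toReal) *
      ∑ U : {U : 𝒜.Index // U ∈ frontier E},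
        (coeff E U : ℝ) * Real.exp (2 * lam * (m (U.1 : Set T)).toReal))

/-- The Ornstein-Uhlenbeck transition system: Gaussian laws, which are Dirac masses when the variance
vanishes. -/
def ouTransition {𝒜 : IndexingCollection T} (m : @Measure T 𝒜.sigmaField) (lam sig : ℝ)
    (A : 𝒜.Index) (E : Finset 𝒜.Index) (x : {U : 𝒜.Index // U ∈ frontier E} → ℝ) : Measure ℝ :=
  gaussianReal (ouMean m lam A E x) (ouVariance m lam sig A E).toNNReal

/-- `X` is, under `P`, a set-indexed Ornstein-Uhlenbeck process with initial law `ν` and parameters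
`lam`, `sig`. -/
structure IsSetIndexedOU {𝒜 : IndexingCollection T} (m : @Measure T 𝒜.sigmaField) (lam sig : ℝ)
    (ν : Measure ℝ) {Ω : Type*} [MeasurableSpace Ω] (X : 𝒜.Index → Ω → ℝ) (P : Measure Ω) :
    Prop where
  measurable : ∀ U, Measurable (X U)
  initial : P.map (X 𝒜.base) = ν
  markov : IsCMarkov X P (ouTransition m lam sig)

/-- The canonical process on the space of all real functions on the collection. -/
def canonical (𝒜 : IndexingCollection T) (U : 𝒜.Index) (ω : 𝒜.Index → ℝ) : ℝ := ω U

end IndexingCollection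

end

/-! Put Y_U = exp(λ m(U)) X_U and k(U,V) = σ²/(2λ) (exp(2λ m(U ∩ V)) - 1). The core statement,
`HasScaledLaw`, is that every finite sum ∑ a_U Y_U is normal with mean x ∑ a_U and variance ∑ a_U
a_V k(U,V). Gaussianity and the means are then immediate, and polarization together with m(U △ V) =
m(U) + m(V) - 2 m(U ∩ V) gives the covariance.

The core statement is proved by induction on finite intersection-stable families containing ∅'.
Remove a maximal member A ≠ ∅' and let B be the union of the maximal remaining members below A.
Every remaining member misses A \ B, so by the Markov property Y_A is, given all of them, normal
with mean ∑ c_U Y_U and a deterministic variance. Adding a_A Y_A therefore replaces a by a + a_A c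
on the remaining family and convolves with a centered Gaussian
(`map_add_const_mul_eq_conv_gaussianReal`). The quadratic form of k behaves in the same way:
inclusion-exclusion gives ∑ c_V k(U,V) = k(U,A) (`sum_coeff_mul_meet`), and completing the square
(`sum_sum_insert_mul_kernel`) matches the variances.

As `toNNReal` truncates at 0, the transition variance must also be shown nonnegative; this comes
from the positive semidefiniteness of exp(c m(U ∩ V)) (`sum_mul_exp_measureReal_inter_nonneg`). -/

/-! ### Positive semidefinite kernels built from the measure of intersections. -/

section PositiveDefinite

variable {α ι : Type*} {mα : MeasurableSpace α} {μ : Measure α} {s : Finset ι} {A : ι → Set α}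

/-- The powers of the kernel `(A, B) ↦ μ (A ∩ B)` are positive semidefinite. -/
lemma sum_mul_measureReal_inter_pow_nonneg (hA : ∀ i ∈ s, MeasurableSet (A i))
    (hfin : ∀ i ∈ s, μ (A i) ≠ ∞) (n : ℕ) (a : ι → ℝ) :
    0 ≤ ∑ i ∈ s, ∑ j ∈ s, a i * a j * μ.real (A i ∩ A j) ^ n := by
  induction n generalizing a with
  | zero =>
    simp only [pow_zero, mul_one, ← Finset.sum_mul_sum]
    exact mul_self_nonneg _
  | succ n ih =>
    have hint : ∀ i ∈ s, ∀ j ∈ s, Integrable ((A i ∩ A j).indicator (1 : α → ℝ)) μ :=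
      fun i hi j hj => (integrable_indicator_iff ((hA i hi).inter (hA j hj))).2 <|
        integrableOn_const (measure_ne_top_of_subset Set.inter_subset_left (hfin i hi))
    -- One factor is written as the integral of a product of indicators. For fixed t the indicators
    -- are absorbed into the coefficients, so the integrand is nonnegative by induction.
    have key : ∑ i ∈ s, ∑ j ∈ s, a i * a j * μ.real (A i ∩ A j) ^ (n + 1) =
        ∫ t, ∑ i ∈ s, ∑ j ∈ s, (a i * (A i).indicator 1 t) * (a j * (A j).indicator 1 t) *
          μ.real (A i ∩ A j) ^ n ∂μ := by
      have hmul : ∀ i j t, (a i * (A i).indicator 1 t) * (a j * (A j).indicator 1 t) *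
          μ.real (A i ∩ A j) ^ n =
          (a i * a j * μ.real (A i ∩ A j) ^ n) * (A i ∩ A j).indicator (1 : α → ℝ) t := by
        intro i j t
        rw [Set.inter_indicator_one, Pi.mul_apply]
        ring
      simp only [hmul]
      rw [integral_finsetSum _ fun i hi => integrable_finsetSum _ fun j hj =>
        (hint i hi j hj).const_mul _]
      refine Finset.sum_congr rfl fun i hi => ?_
      rw [integral_finsetSum _ fun j hj => (hint i hi j hj).const_mul _]
      refine Finset.sum_congr rfl fun j hj => ?_
      rw [integral_const_mul, integral_indicator_one ((hA i hi).inter (hA j hj))]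
      ring
    rw [key]
    exact integral_nonneg fun t => ih _

/-- The kernel `(A, B) ↦ exp (c * μ (A ∩ B))` is positive semidefinite for `0 ≤ c`. -/
lemma sum_mul_exp_measureReal_inter_nonneg (hA : ∀ i ∈ s, MeasurableSet (A i))
    (hfin : ∀ i ∈ s, μ (A i) ≠ ∞) {c : ℝ} (hc : 0 ≤ c) (a : ι → ℝ) :
    0 ≤ ∑ i ∈ s, ∑ j ∈ s, a i * a j * Real.exp (c * μ.real (A i ∩ A j)) := by
  have hsum : HasSum (fun n : ℕ => ∑ i ∈ s, ∑ j ∈ s,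
      a i * a j * ((c * μ.real (A i ∩ A j)) ^ n / n.factorial))
      (∑ i ∈ s, ∑ j ∈ s, a i * a j * Real.exp (c * μ.real (A i ∩ A j))) := by
    refine hasSum_sum fun i _ => hasSum_sum fun j _ => HasSum.mul_left _ ?_
    rw [Real.exp_eq_exp_ℝ]
    exact NormedSpace.expSeries_div_hasSum_exp _
  refine hsum.nonneg fun n => ?_
  have := mul_nonneg (div_nonneg (pow_nonneg hc n) n.factorial.cast_nonneg)
    (sum_mul_measureReal_inter_pow_nonneg hA hfin n a)
  convert this using 1
  simp only [Finset.mul_sum]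
  refine Finset.sum_congr rfl fun i _ => Finset.sum_congr rfl fun j _ => ?_
  rw [mul_pow]
  ring

end PositiveDefinite

/-! ### Conditionally Gaussian variables. -/

section GaussianStep

variable {Ω : Type*} {𝒢 mΩ : MeasurableSpace Ω} {P : Measure[mΩ] Ω} {M Y : Ω → ℝ} {v : ℝ≥0}

/-- If `Y` has the conditional law `gaussianReal (M ·) v` given `𝒢`, then, for `g` and `M`
measurable for `𝒢`, the pair `(g, Y)` has the law of `(g, M + Z)` with `Z` an independent centered
Gaussian variable of variance `v`. -/
lemma map_prodMk_eq_of_condLExp_eq_gaussianReal [IsProbabilityMeasure P] (h𝒢 : 𝒢 ≤ mΩ)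
    {β : Type*} [MeasurableSpace β] {g : Ω → β} (hg : Measurable[𝒢] g) (hM : Measurable[𝒢] M)
    (hY : Measurable Y)
    (h : ∀ t : Set ℝ, MeasurableSet t → condLExp 𝒢 P (fun ω => t.indicator 1 (Y ω)) =ᵐ[P]
      fun ω => gaussianReal (M ω) v t) :
    P.map (fun ω => (g ω, Y ω)) =
      (P.prod (gaussianReal 0 v)).map (fun p => (g p.1, M p.1 + p.2)) := by
  have hg' := hg.mono h𝒢 le_rfl
  have hM' := hM.mono h𝒢 le_rfl
  have : IsProbabilityMeasure (P.map (fun ω => (g ω, Y ω))) :=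
    Measure.isProbabilityMeasure_map (by fun_prop)
  refine Measure.ext_prod fun {s t} hs ht => ?_
  rw [Measure.map_apply (by fun_prop) (hs.prod ht), Measure.map_apply (by fun_prop) (hs.prod ht),
    Measure.prod_apply ((by fun_prop : Measurable fun p : Ω × ℝ => (g p.1, M p.1 + p.2))
      (hs.prod ht))]
  have h1 : P ((fun ω => (g ω, Y ω)) ⁻¹' s ×ˢ t) =
      ∫⁻ ω in g ⁻¹' s, t.indicator 1 (Y ω) ∂P := by
    have : (fun ω => t.indicator (1 : ℝ → ℝ≥0∞) (Y ω)) = (Y ⁻¹' t).indicator 1 := rfl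
    rw [this, lintegral_indicator_one (hY ht), Measure.restrict_apply (hY ht), Set.inter_comm]
    rfl
  rw [h1, ← setLIntegral_condLExp h𝒢 P _ (hg hs),
    setLIntegral_congr_fun_ae (hg' hs) ((h t ht).mono fun ω hω _ => hω),
    ← lintegral_indicator (hg' hs)]
  refine lintegral_congr fun ω => ?_
  by_cases hω : g ω ∈ s
  · rw [Set.indicator_of_mem (by exact hω)]
    have := gaussianReal_map_const_add (μ := 0) (v := v) (M ω)
    rw [zero_add] at this
    rw [← this, Measure.map_apply (by fun_prop) ht]
    congr 1
    ext z
    simp [hω]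
  · rw [Set.indicator_of_notMem (by exact hω)]
    symm
    convert measure_empty (μ := gaussianReal 0 v)
    ext z
    simp [hω]

/-- Given `𝒢`, `Y` is `M` plus independent centered noise, so W + bY is W + bM plus b times that
noise. -/
lemma map_add_const_mul_eq_conv_gaussianReal [IsProbabilityMeasure P] (h𝒢 : 𝒢 ≤ mΩ)
    {W : Ω → ℝ} (hW : Measurable[𝒢] W) (hM : Measurable[𝒢] M) (hY : Measurable Y)
    (h : ∀ t : Set ℝ, MeasurableSet t → condLExp 𝒢 P (fun ω => t.indicator 1 (Y ω)) =ᵐ[P]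
      fun ω => gaussianReal (M ω) v t) (b : ℝ) :
    P.map (fun ω => W ω + b * Y ω) =
      (P.map (fun ω => W ω + b * M ω)).conv (gaussianReal 0 (.mk (b ^ 2) (sq_nonneg _) * v)) := by
  have hW' := hW.mono h𝒢 le_rfl
  have hM' := hM.mono h𝒢 le_rfl
  have key := congrArg (Measure.map fun q : ℝ × ℝ => q.1 + b * q.2)
    (map_prodMk_eq_of_condLExp_eq_gaussianReal h𝒢 hW hM hY h)
  rw [Measure.map_map (by fun_prop) (by fun_prop), Measure.map_map (by fun_prop) (by fun_prop)]
    at key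
  have hv := gaussianReal_map_const_mul (μ := 0) (v := v) b
  rw [mul_zero] at hv
  rw [← hv, Measure.conv, Measure.map_prod_map _ _ (by fun_prop) (by fun_prop),
    Measure.map_map (by fun_prop) (by fun_prop)]
  refine key.trans ?_
  congr 1
  ext p
  simp only [Function.comp_apply, Prod.map]
  ring

end GaussianStep

/-! ### Inclusion-exclusion coefficients. -/

namespace IndexingCollection

variable {T : Type*} [TopologicalSpace T] {𝒜 : IndexingCollection T}

/-- The intersection of two members of the collection. -/
def meet (U V : 𝒜.Index) : 𝒜.Index :=
  ⟨(U : Set T) ∩ V, by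
    simpa using 𝒜.sInter_mem {(U : Set T), (V : Set T)}
      (by rintro _ (rfl | rfl); exacts [U.2, V.2]) ⟨U, by simp⟩⟩

@[simp] lemma coe_meet (U V : 𝒜.Index) : (meet U V : Set T) = (U : Set T) ∩ V := rfl

lemma base_le (U : 𝒜.Index) : 𝒜.base ≤ U := Set.sInter_subset_of_mem U.2

lemma coeff_eq_zero_of_notMem_semilattice {E : Finset 𝒜.Index} {U : 𝒜.Index}
    (hU : U ∉ semilattice E) : coeff E U = 0 := by
  classical
  rw [coeff, Finset.filter_eq_empty_iff.2, Finset.sum_empty]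
  rintro J hJ ⟨hJn, hJU⟩
  exact hU ⟨J, Finset.mem_powerset.1 hJ, hJn, hJU.symm⟩

lemma coeff_eq_zero_of_notMem_frontier {E : Finset 𝒜.Index} {U : 𝒜.Index}
    (hU : U ∉ frontier E) : coeff E U = 0 := by
  classical
  by_contra h
  refine hU (Finset.mem_filter.2 ⟨?_, .inr h⟩)
  rw [Set.Finite.mem_toFinset]
  exact Not.imp_symm coeff_eq_zero_of_notMem_semilattice h

lemma mem_semilattice_of_mem_frontier {E : Finset 𝒜.Index} {U : 𝒜.Index}
    (hU : U ∈ frontier E) : U ∈ semilattice E := by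
  classical
  exact (Set.Finite.mem_toFinset _).1 (Finset.mem_filter.1 hU).1

lemma subset_of_mem_semilattice {E : Finset 𝒜.Index} {U : 𝒜.Index} {B : Set T}
    (hE : ∀ V ∈ E, (V : Set T) ⊆ B) (hU : U ∈ semilattice E) : (U : Set T) ⊆ B := by
  obtain ⟨J, hJ, ⟨V, hV⟩, hJU⟩ := hU
  rw [hJU]
  exact (Set.biInter_subset_of_mem hV).trans (hE V (hJ hV))

/-- The border keeps every set of nonzero coefficient, so border sums may be taken over any larger
family, on which inclusion-exclusion applies. -/
lemma sum_frontier_coeff_mul {E S : Finset 𝒜.Index} (hS : semilattice E ⊆ S)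
    (g : 𝒜.Index → ℝ) :
    ∑ U : {U : 𝒜.Index // U ∈ frontier E}, (coeff E U : ℝ) * g U =
      ∑ U ∈ S, (coeff E U : ℝ) * g U := by
  classical
  rw [Finset.sum_coe_sort (frontier E) fun U => (coeff E U : ℝ) * g U]
  refine Finset.sum_subset (fun U hU => hS (mem_semilattice_of_mem_frontier hU)) fun U _ hU => ?_
  rw [coeff_eq_zero_of_notMem_frontier hU, Int.cast_zero, zero_mul]

lemma sum_coeff_mul {E S : Finset 𝒜.Index} (hS : semilattice E ⊆ S) (g : Set T → ℝ) :
    ∑ U ∈ S, (coeff E U : ℝ) * g U =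
      ∑ J ∈ E.powerset with J.Nonempty, (-1) ^ (J.card + 1) * g (⋂ V ∈ J, (V : Set T)) := by
  classical
  have hmem : ∀ J ∈ E.powerset.filter (·.Nonempty), ∃ U ∈ S,
      (U : Set T) = ⋂ V ∈ J, (V : Set T) := by
    intro J hJ
    obtain ⟨hJE, hJn⟩ := Finset.mem_filter.1 hJ
    have hU : (⋂ V ∈ J, (V : Set T)) ∈ 𝒜.sets := by
      have := 𝒜.sInter_mem ((↑) '' (J : Set 𝒜.Index)) (by rintro _ ⟨V, -, rfl⟩; exact V.2)
        (Set.Nonempty.image _ hJn)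
      rwa [Set.sInter_image] at this
    exact ⟨⟨_, hU⟩, hS ⟨J, Finset.mem_powerset.1 hJE, hJn, rfl⟩, rfl⟩
  have : Nonempty 𝒜.Index := ⟨𝒜.base⟩
  choose! φ hφS hφ using hmem
  rw [← Finset.sum_fiberwise_of_maps_to hφS]
  refine Finset.sum_congr rfl fun U _ => ?_
  rw [coeff, Int.cast_sum, Finset.sum_mul]
  have hfilter : E.powerset.filter (fun J : Finset 𝒜.Index =>
      J.Nonempty ∧ (⋂ V ∈ J, (V : Set T)) = (U : Set T)) =
      (E.powerset.filter (·.Nonempty)).filter (φ · = U) := by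
    rw [← Finset.filter_filter]
    refine Finset.filter_congr fun J hJ => ?_
    rw [← hφ J hJ, Subtype.val_injective.eq_iff]
  rw [hfilter]
  refine Finset.sum_congr rfl fun J hJ => ?_
  rw [← hφ J (Finset.mem_filter.1 hJ).1, (Finset.mem_filter.1 hJ).2]
  push_cast
  rfl

/-- The inclusion-exclusion formula, for the sets contained in a member of `E`. -/
lemma sum_coeff_mul_inter {E S : Finset 𝒜.Index} (hS : semilattice E ⊆ S) {V : 𝒜.Index}
    (hV : V ∈ E) {W : Set T} (hW : W ⊆ V) (g : Set T → ℝ) :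
    ∑ U ∈ S, (coeff E U : ℝ) * g (U ∩ W) = g W := by
  classical
  -- With J = ∅ included, the terms of J and J ∪ {V} cancel, since W ⊆ V. The empty term, whose
  -- intersection is the whole space, equals -g(W) and yields the right-hand side.
  have hzero : ∑ J ∈ E.powerset, (-1) ^ (J.card + 1) * g ((⋂ V ∈ J, (V : Set T)) ∩ W) = 0 := by
    rw [← Finset.insert_erase hV, Finset.sum_powerset_insert (Finset.notMem_erase V E),
      ← Finset.sum_add_distrib]
    refine Finset.sum_eq_zero fun J hJ => ?_
    have hVJ : V ∉ J := fun h => Finset.notMem_erase V E (Finset.mem_powerset.1 hJ h)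
    rw [Finset.card_insert_of_notMem hVJ, Finset.set_biInter_insert, Set.inter_comm (V : Set T),
      Set.inter_assoc, Set.inter_eq_right.2 hW]
    ring
  rw [sum_coeff_mul hS fun B => g (B ∩ W)]
  rw [← Finset.sum_filter_add_sum_filter_not _ (·.Nonempty)] at hzero
  have hempty : E.powerset.filter (fun J => ¬ J.Nonempty) = {∅} := by
    ext J
    simp only [Finset.mem_filter, Finset.mem_powerset, Finset.not_nonempty_iff_eq_empty,
      Finset.mem_singleton]
    exact ⟨fun h => h.2, fun h => ⟨h ▸ Finset.empty_subset E, h⟩⟩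
  rw [hempty, Finset.sum_singleton] at hzero
  simp only [Finset.card_empty, zero_add, pow_one, Finset.notMem_empty, Set.iInter_of_empty,
    Set.iInter_univ, Set.univ_inter] at hzero
  linarith

end IndexingCollection

/-! ### Intersection-stable families and the reproducing property. -/

namespace IndexingCollection

variable {T : Type*} [TopologicalSpace T] {𝒜 : IndexingCollection T}

/-- Completing the square: if `k · A` is the combination of the `k · V` with coefficients `c`, then
the quadratic form of `k` on `insert A S` splits off a square. -/
lemma sum_sum_insert_mul_kernel {ι : Type*} [DecidableEq ι] {S : Finset ι} {A : ι} (hA : A ∉ S)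
    {k : ι → ι → ℝ} (hk : ∀ i j, k i j = k j i) {c : ι → ℝ}
    (hc : ∀ i ∈ S, ∑ j ∈ S, c j * k i j = k i A) (a : ι → ℝ) :
    ∑ i ∈ insert A S, ∑ j ∈ insert A S, a i * a j * k i j =
      ∑ i ∈ S, ∑ j ∈ S, (a i + a A * c i) * (a j + a A * c j) * k i j +
        a A ^ 2 * (k A A - ∑ i ∈ S, c i * k i A) := by
  have h1 : ∀ b : ι → ℝ, ∑ i ∈ S, ∑ j ∈ S, b i * c j * k i j = ∑ i ∈ S, b i * k i A := fun b =>
    Finset.sum_congr rfl fun i hi => by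
      rw [← hc i hi, Finset.mul_sum]
      exact Finset.sum_congr rfl fun j _ => by ring
  have h2 : ∑ i ∈ S, ∑ j ∈ S, c i * a j * k i j = ∑ i ∈ S, a i * k i A := by
    rw [← h1 a, Finset.sum_comm]
    exact Finset.sum_congr rfl fun i _ => Finset.sum_congr rfl fun j _ => by rw [hk]; ring
  have h3 : ∑ i ∈ S, ∑ j ∈ S, (a i + a A * c i) * (a j + a A * c j) * k i j =
      ∑ i ∈ S, ∑ j ∈ S, a i * a j * k i j + a A * ∑ i ∈ S, ∑ j ∈ S, a i * c j * k i j +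
        a A * ∑ i ∈ S, ∑ j ∈ S, c i * a j * k i j +
        a A ^ 2 * ∑ i ∈ S, ∑ j ∈ S, c i * c j * k i j := by
    simp only [Finset.mul_sum, ← Finset.sum_add_distrib]
    exact Finset.sum_congr rfl fun i _ => Finset.sum_congr rfl fun j _ => by ring
  rw [h3, h2, h1 a, h1 c]
  simp only [Finset.sum_insert hA, Finset.sum_add_distrib]
  have h4 : ∑ j ∈ S, a A * a j * k A j = a A * ∑ i ∈ S, a i * k i A := by
    rw [Finset.mul_sum]
    exact Finset.sum_congr rfl fun i _ => by rw [hk A i]; ring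
  have h5 : ∑ i ∈ S, a i * a A * k i A = a A * ∑ i ∈ S, a i * k i A := by
    rw [Finset.mul_sum]
    exact Finset.sum_congr rfl fun i _ => by ring
  rw [h4, h5]
  ring

/-- The maximal members of `S` below `A` form `E`; the base set makes it nonempty. -/
lemma exists_isExtremal_of_base_mem {S : Finset 𝒜.Index} (hS : 𝒜.base ∈ S) (A : 𝒜.Index) :
    ∃ E : Finset 𝒜.Index, IsExtremal E ∧ (∀ V ∈ E, V ∈ S ∧ V ≤ A) ∧
      ∀ W ∈ S, W ≤ A → ∃ V ∈ E, W ≤ V := by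
  classical
  set F := S.filter (· ≤ A) with hF
  have hcover : ∀ W ∈ S, W ≤ A → ∃ V ∈ F.filter (Maximal (· ∈ F)), W ≤ V := by
    intro W hW hWA
    obtain ⟨V, hWV, hV⟩ := F.exists_le_maximal (Finset.mem_filter.2 ⟨hW, hWA⟩)
    exact ⟨V, Finset.mem_filter.2 ⟨hV.prop, hV⟩, hWV⟩
  refine ⟨F.filter (Maximal (· ∈ F)), ⟨?_, ?_⟩, ?_, hcover⟩
  · obtain ⟨V, hV, -⟩ := hcover _ hS (base_le A)
    exact ⟨V, hV⟩
  · intro V hV W hW hne hVW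
    obtain ⟨hWF, -⟩ := Finset.mem_filter.1 hW
    exact hne ((Finset.mem_filter.1 hV).2.eq_of_le hWF hVW)
  · exact fun V hV => Finset.mem_filter.1 (Finset.mem_filter.1 hV).1

lemma semilattice_subset_of_meet_mem {E S : Finset 𝒜.Index} (hE : E ⊆ S)
    (hS : ∀ U ∈ S, ∀ V ∈ S, meet U V ∈ S) : semilattice E ⊆ S := by
  classical
  rintro U ⟨J, hJE, hJ, hU⟩
  have key : ∀ J : Finset 𝒜.Index, J.Nonempty → J ⊆ S →
      ∃ U ∈ S, (U : Set T) = ⋂ V ∈ J, (V : Set T) := by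
    intro J hJ
    induction hJ using Finset.Nonempty.cons_induction with
    | singleton V => exact fun h => ⟨V, h (Finset.mem_singleton_self V), by simp⟩
    | cons V J hV hJ ih =>
      intro h
      rw [Finset.cons_eq_insert] at h ⊢
      obtain ⟨U, hU, hUJ⟩ := ih fun W hW => h (Finset.mem_insert_of_mem hW)
      exact ⟨meet V U, hS _ (h (Finset.mem_insert_self V J)) _ hU, by
        rw [Finset.set_biInter_insert, coe_meet, hUJ]⟩
  obtain ⟨W, hW, hWJ⟩ := key J hJ (hJE.trans hE)
  rwa [Subtype.ext (hU.trans hWJ.symm)]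

lemma exists_finset_meet_mem (I : Finset 𝒜.Index) :
    ∃ S : Finset 𝒜.Index, I ⊆ S ∧ 𝒜.base ∈ S ∧ ∀ U ∈ S, ∀ V ∈ S, meet U V ∈ S := by
  classical
  refine ⟨(finite_semilattice (insert 𝒜.base I)).toFinset, fun U hU => ?_, ?_, ?_⟩
  · rw [Set.Finite.mem_toFinset]
    exact ⟨{U}, by simp [hU], Finset.singleton_nonempty U, by simp⟩
  · rw [Set.Finite.mem_toFinset]
    exact ⟨{𝒜.base}, by simp, Finset.singleton_nonempty _, by simp⟩
  · simp only [Set.Finite.mem_toFinset]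
    rintro U ⟨J, hJ, hJn, hU⟩ V ⟨K, hK, -, hV⟩
    exact ⟨J ∪ K, Finset.union_subset hJ hK, hJn.mono Finset.subset_union_left, by
      rw [Finset.set_biInter_inter, coe_meet, hU, hV]⟩

/-- The reproducing property of the coefficients, for a family stable by intersections whose members
below `A` are all below a member of `E`. -/
lemma sum_coeff_mul_meet {E S : Finset 𝒜.Index} {A : 𝒜.Index} (hS : semilattice E ⊆ S)
    (hmeet : ∀ U ∈ S, ∃ V ∈ E, (U : Set T) ∩ A ⊆ V) (hEA : ∀ V ∈ E, V ≤ A) (g : Set T → ℝ)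
    {U : 𝒜.Index} (hU : U ∈ S) :
    ∑ V ∈ S, (coeff E V : ℝ) * g (U ∩ V) = g (U ∩ A) := by
  obtain ⟨V₀, hV₀, hUV₀⟩ := hmeet U hU
  rw [← sum_coeff_mul_inter hS hV₀ hUV₀ g]
  refine Finset.sum_congr rfl fun V _ => ?_
  -- Only sets V ⊆ A carry a nonzero coefficient, and for them V ∩ (U ∩ A) = U ∩ V.
  by_cases hV : V ∈ semilattice E
  · have : (V : Set T) ⊆ A := subset_of_mem_semilattice hEA hV
    rw [Set.inter_comm (U : Set T) A, ← Set.inter_assoc, Set.inter_eq_left.2 this, Set.inter_comm]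
  · rw [coeff_eq_zero_of_notMem_semilattice hV, Int.cast_zero, zero_mul, zero_mul]

lemma sum_coeff_mul_of_le {E S : Finset 𝒜.Index} {A : 𝒜.Index} (hEA : ∀ V ∈ E, V ≤ A)
    (g : Set T → ℝ) :
    ∑ V ∈ S, (coeff E V : ℝ) * g (V ∩ A) = ∑ V ∈ S, (coeff E V : ℝ) * g V := by
  refine Finset.sum_congr rfl fun V _ => ?_
  by_cases hV : V ∈ semilattice E
  · rw [Set.inter_eq_left.2 (subset_of_mem_semilattice hEA hV)]
  · rw [coeff_eq_zero_of_notMem_semilattice hV, Int.cast_zero, zero_mul, zero_mul]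

lemma measurableSet_coe (U : 𝒜.Index) : MeasurableSet[𝒜.sigmaField] (U : Set T) :=
  MeasurableSpace.measurableSet_generateFrom U.2

lemma IsAdmissible.ne_top {m : @Measure T 𝒜.sigmaField} (hm : 𝒜.IsAdmissible m) (U : 𝒜.Index) :
    m U ≠ ∞ :=
  (hm.lt_top _ (𝒜.isCompact _ U.2) (measurableSet_coe U)).ne

/-- The inclusion-exclusion sum of `exp (c * m ·)` over the members of `E` is at most its value at
any set of the collection containing them. -/
lemma IsAdmissible.sum_coeff_mul_exp_le {m : @Measure T 𝒜.sigmaField} (hm : 𝒜.IsAdmissible m)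
    {c : ℝ} (hc : 0 ≤ c) {E S : Finset 𝒜.Index} {A : 𝒜.Index} (hA : A ∉ S)
    (hS : semilattice E ⊆ S) (hmeet : ∀ U ∈ S, ∃ V ∈ E, (U : Set T) ∩ A ⊆ V)
    (hEA : ∀ V ∈ E, V ≤ A) :
    ∑ U ∈ S, (coeff E U : ℝ) * Real.exp (c * (m (U : Set T)).toReal) ≤
      Real.exp (c * (m (A : Set T)).toReal) := by
  classical
  set g : Set T → ℝ := fun B => Real.exp (c * (m B).toReal) with hg
  -- With a = 1 at `A` and a = -c on `S`, the shifted form vanishes after completing the square,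
  -- leaving exactly the difference to be bounded.
  obtain ⟨a, haA, haS⟩ : ∃ a : 𝒜.Index → ℝ, a A = 1 ∧ ∀ U ∈ S, a U + 1 * coeff E U = 0 :=
    ⟨fun U => if U = A then 1 else -coeff E U, if_pos rfl, fun U hU => by
      simp [ne_of_mem_of_not_mem hU hA]⟩
  have h := sum_sum_insert_mul_kernel hA (k := fun U V => g (U ∩ V))
    (fun U V => by rw [Set.inter_comm]) (c := fun V => coeff E V)
    (fun U hU => sum_coeff_mul_meet hS hmeet hEA g hU) a
  rw [haA, Finset.sum_eq_zero (s := S) fun U hU => Finset.sum_eq_zero fun V _ => by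
    rw [haS U hU, zero_mul, zero_mul], sum_coeff_mul_of_le hEA g, zero_add, one_pow, one_mul,
    Set.inter_self] at h
  have hpos := sum_mul_exp_measureReal_inter_nonneg (μ := m) (s := insert A S)
    (A := fun U : 𝒜.Index => (U : Set T)) (fun U _ => measurableSet_coe U)
    (fun U _ => hm.ne_top U) hc a
  exact sub_nonneg.1 (hpos.trans_eq h)

end IndexingCollection

/-! ### Laws of linear combinations, by induction on the family. -/

noncomputable section

namespace IndexingCollection

variable {T : Type*} [TopologicalSpace T] {𝒜 : IndexingCollection T}
  {m : @Measure T 𝒜.sigmaField} {lam sig x : ℝ} {Ω : Type*} {X : 𝒜.Index → Ω → ℝ}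

/-- The covariance kernel of the process `exp (lam * m U) * X U`. -/
def ouKernel (m : @Measure T 𝒜.sigmaField) (lam sig : ℝ) (U V : 𝒜.Index) : ℝ :=
  sig ^ 2 / (2 * lam) * (Real.exp (2 * lam * (m ((U : Set T) ∩ V)).toReal) - 1)

lemma ouKernel_comm (U V : 𝒜.Index) : ouKernel m lam sig U V = ouKernel m lam sig V U := by
  rw [ouKernel, ouKernel, Set.inter_comm]

/-- A linear combination of the variables `exp (lam * m U) * X U`. -/
def scaledSum (m : @Measure T 𝒜.sigmaField) (lam : ℝ) (X : 𝒜.Index → Ω → ℝ)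
    (S : Finset 𝒜.Index) (a : 𝒜.Index → ℝ) (ω : Ω) : ℝ :=
  ∑ U ∈ S, a U * (Real.exp (lam * (m (U : Set T)).toReal) * X U ω)

/-- Under `P`, the linear combination with coefficients `a` of the variables
`exp (lam * m U) * X U`, for `U ∈ S`, has the Gaussian law of the Ornstein-Uhlenbeck process
started at `x`. -/
def HasScaledLaw (m : @Measure T 𝒜.sigmaField) (lam sig x : ℝ) (X : 𝒜.Index → Ω → ℝ)
    [MeasurableSpace Ω] (P : Measure Ω) (S : Finset 𝒜.Index) (a : 𝒜.Index → ℝ) : Prop :=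
  0 ≤ ∑ U ∈ S, ∑ V ∈ S, a U * a V * ouKernel m lam sig U V ∧
    P.map (scaledSum m lam X S a) = gaussianReal (x * ∑ U ∈ S, a U)
      (∑ U ∈ S, ∑ V ∈ S, a U * a V * ouKernel m lam sig U V).toNNReal

lemma measurable_scaledSum {𝒢 : MeasurableSpace Ω} {S : Finset 𝒜.Index}
    (hX : ∀ U ∈ S, Measurable[𝒢] (X U)) (a : 𝒜.Index → ℝ) :
    Measurable[𝒢] (scaledSum m lam X S a) := by
  unfold scaledSum
  exact Finset.measurable_fun_sum S fun U hU => ((hX U hU).const_mul _).const_mul _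

lemma measurable_strongPast {C : Set T} {U : 𝒜.Index} (hU : Disjoint (U : Set T) C) :
    Measurable[strongPast X C] (X U) := by
  refine measurable_iff_comap_le.2 ?_
  refine le_trans ?_ (le_iSup₂_of_le (U : Set T) ⟨⟨{U}, Finset.singleton_nonempty U, ?_⟩, hU⟩
    le_rfl)
  · exact le_iSup₂_of_le (f := fun (V : 𝒜.Index) (_ : (V : Set T) ⊆ U) =>
      MeasurableSpace.comap (X V) inferInstance) U subset_rfl le_rfl
  · simp [union]

namespace IsSetIndexedOU

variable [mΩ : MeasurableSpace Ω] {P : Measure Ω} {ν : Measure ℝ}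

lemma strongPast_le (h : IsSetIndexedOU m lam sig ν X P) (C : Set T) : strongPast X C ≤ mΩ :=
  iSup₂_le fun _ _ => iSup₂_le fun V _ => (h.measurable V).comap_le

/-- The Markov property in the form needed for the Gaussian step: the border sum in the transition
mean becomes a `scaledSum` over all of `S`. -/
lemma condLExp_indicator (h : IsSetIndexedOU m lam sig ν X P) {A : 𝒜.Index}
    {E S : Finset 𝒜.Index} (hE : IsExtremal E) (hEA : ∀ V ∈ E, V ≤ A)
    (hS : semilattice E ⊆ S) {t : Set ℝ} (ht : MeasurableSet t) :
    condLExp (strongPast X ((A : Set T) \ union E)) P (fun ω => t.indicator 1 (X A ω)) =ᵐ[P]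
      fun ω => gaussianReal (Real.exp (-lam * (m (A : Set T)).toReal) *
        scaledSum m lam X S (fun U => coeff E U) ω) (ouVariance m lam sig A E).toNNReal t := by
  obtain ⟨h1, h2⟩ := h.markov A E hE (Set.iUnion₂_subset hEA) (t.indicator 1)
    (measurable_one.indicator ht)
  have hcoe : ∀ y, ((t.indicator 1 y : ℝ≥0) : ℝ≥0∞) = t.indicator 1 y := fun y => by
    by_cases hy : y ∈ t <;> simp [hy]
  simp only [hcoe] at h1 h2
  refine (h1.trans h2).trans (.of_forall fun ω => ?_)
  simp only [lintegral_indicator_one ht, ouTransition]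
  congr 2
  rw [ouMean, scaledSum, ← sum_frontier_coeff_mul hS]
  simp only [frontierVector, mul_assoc, mul_comm (X _ ω)]

/-- The inductive step: adding a set `A` to a stable family none of whose members contains `A`. -/
lemma hasScaledLaw_insert [DecidableEq 𝒜.Index] [IsProbabilityMeasure P]
    (hm : 𝒜.IsAdmissible m) (hlam : 0 < lam)
    (h : IsSetIndexedOU m lam sig ν X P) {S : Finset 𝒜.Index} (hbase : 𝒜.base ∈ S)
    (hmeet : ∀ U ∈ S, ∀ V ∈ S, meet U V ∈ S) {A : 𝒜.Index} (hA : A ∉ S)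
    (hSA : ∀ U ∈ S, meet U A ∈ S) (ih : ∀ a, HasScaledLaw m lam sig x X P S a)
    (a : 𝒜.Index → ℝ) : HasScaledLaw m lam sig x X P (insert A S) a := by
  obtain ⟨E, hE, hES, hcover⟩ := exists_isExtremal_of_base_mem hbase A
  have hEA : ∀ V ∈ E, V ≤ A := fun V hV => (hES V hV).2
  have hS : semilattice E ⊆ S := semilattice_subset_of_meet_mem (fun V hV => (hES V hV).1) hmeet
  have hcov : ∀ U ∈ S, ∃ V ∈ E, (U : Set T) ∩ A ⊆ V := fun U hU =>
    hcover (meet U A) (hSA U hU) Set.inter_subset_right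
  have hdisj : ∀ U ∈ S, Disjoint (U : Set T) ((A : Set T) \ union E) := fun U hU => by
    obtain ⟨V, hV, hUV⟩ := hcov U hU
    exact Set.disjoint_left.2 fun t htU htA =>
      htA.2 (Set.mem_biUnion hV (hUV ⟨htU, htA.1⟩))
  set c : 𝒜.Index → ℝ := fun U => coeff E U with hc
  set g : Set T → ℝ := fun B => sig ^ 2 / (2 * lam) *
    (Real.exp (2 * lam * (m B).toReal) - 1) with hg
  -- Inclusion-exclusion for the constant 1. It preserves the mean and accounts for the -1 in the
  -- kernel.
  have hsumc : ∑ U ∈ S, c U = 1 := by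
    obtain ⟨V, hV⟩ := hE.1
    simpa using sum_coeff_mul_inter hS hV subset_rfl fun _ => 1
  have hquad := sum_sum_insert_mul_kernel hA (k := ouKernel m lam sig) ouKernel_comm (c := c)
    (fun U hU => sum_coeff_mul_meet hS hcov hEA g hU) a
  set e : ℝ := Real.exp (lam * (m (A : Set T)).toReal) with he
  have hee : e * Real.exp (-lam * (m (A : Set T)).toReal) = 1 := by
    rw [he, ← Real.exp_add, neg_mul, add_neg_cancel, Real.exp_zero]
  have he2 : e ^ 2 = Real.exp (2 * lam * (m (A : Set T)).toReal) := by
    rw [he, ← Real.exp_nat_mul, Nat.cast_ofNat, mul_assoc]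
  have hvar_eq : e ^ 2 * ouVariance m lam sig A E = sig ^ 2 / (2 * lam) *
      (Real.exp (2 * lam * (m (A : Set T)).toReal) -
        ∑ U ∈ S, c U * Real.exp (2 * lam * (m (U : Set T)).toReal)) := by
    rw [ouVariance, sum_frontier_coeff_mul hS
      fun U => Real.exp (2 * lam * (m (U : Set T)).toReal)]
    have h1 : e ^ 2 * Real.exp (-2 * lam * (m (A : Set T)).toReal) = 1 := by
      rw [he2, ← Real.exp_add]
      simp
    rw [← he2]
    linear_combination (-(sig ^ 2 / (2 * lam)) *
      ∑ U ∈ S, c U * Real.exp (2 * lam * (m (U : Set T)).toReal)) * h1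
  have hvar_nonneg : 0 ≤ ouVariance m lam sig A E := by
    refine nonneg_of_mul_nonneg_right (a := e ^ 2) ?_ (by positivity)
    rw [hvar_eq]
    exact mul_nonneg (by positivity) (sub_nonneg.2
      (hm.sum_coeff_mul_exp_le (by positivity) hA hS hcov hEA))
  have hker : ouKernel m lam sig A A - ∑ U ∈ S, c U * ouKernel m lam sig U A =
      e ^ 2 * ouVariance m lam sig A E := by
    have h1 : ∑ U ∈ S, c U * ouKernel m lam sig U A = ∑ U ∈ S, c U * g U :=
      sum_coeff_mul_of_le hEA g
    have h2 : ∑ U ∈ S, c U * g U = sig ^ 2 / (2 * lam) *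
        (∑ U ∈ S, c U * Real.exp (2 * lam * (m (U : Set T)).toReal) - ∑ U ∈ S, c U) := by
      rw [← Finset.sum_sub_distrib, Finset.mul_sum]
      exact Finset.sum_congr rfl fun U _ => by rw [hg]; ring
    rw [h1, h2, hsumc, hvar_eq, ouKernel, Set.inter_self]
    ring
  rw [hker] at hquad
  -- Conditioning on the past replaces X_A by its conditional mean, which shifts the coefficients by
  -- a_A c, as completing the square does.
  obtain ⟨hnonneg, hlaw⟩ := ih fun U => a U + a A * c U
  have hnonneg' : 0 ≤ a A ^ 2 * (e ^ 2 * ouVariance m lam sig A E) := by positivity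
  refine ⟨hquad ▸ add_nonneg hnonneg hnonneg', ?_⟩
  have hstep := map_add_const_mul_eq_conv_gaussianReal (h.strongPast_le _)
    (measurable_scaledSum (m := m) (lam := lam) (fun U hU => measurable_strongPast (hdisj U hU)) a)
    ((measurable_scaledSum (fun U hU => measurable_strongPast (hdisj U hU)) c).const_mul _)
    (h.measurable A) (fun t ht => h.condLExp_indicator hE hEA hS ht) (a A * e)
  have hleft : scaledSum m lam X (insert A S) a =
      fun ω => scaledSum m lam X S a ω + a A * e * X A ω := by
    ext ω
    rw [scaledSum, Finset.sum_insert hA, scaledSum]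
    ring
  have hright : (fun ω => scaledSum m lam X S a ω + a A * e *
      (Real.exp (-lam * (m (A : Set T)).toReal) * scaledSum m lam X S c ω)) =
      scaledSum m lam X S fun U => a U + a A * c U := by
    ext ω
    have : scaledSum m lam X S (fun U => a U + a A * c U) ω =
        scaledSum m lam X S a ω + a A * scaledSum m lam X S c ω := by
      simp only [scaledSum, Finset.mul_sum, ← Finset.sum_add_distrib]
      exact Finset.sum_congr rfl fun U _ => by ring
    rw [this]
    linear_combination a A * scaledSum m lam X S c ω * hee
  rw [hleft, hstep, hright, hlaw, gaussianReal_conv_gaussianReal, hquad,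
    Real.toNNReal_add hnonneg hnonneg']
  congr 1
  · rw [Finset.sum_insert hA, Finset.sum_add_distrib, ← Finset.mul_sum, hsumc]
    ring
  · congr 1
    ext
    rw [Real.coe_toNNReal _ hnonneg', NNReal.coe_mul, Real.coe_toNNReal _ hvar_nonneg]
    simp only [NNReal.coe_mk]
    ring

/-- Since m(∅') = 0, the scaling is trivial and the kernel vanishes at ∅', in accordance with the
Dirac initial law. -/
lemma hasScaledLaw_base [IsProbabilityMeasure P] (hm : 𝒜.IsAdmissible m)
    (h : IsSetIndexedOU m lam sig (.dirac x) X P) (a : 𝒜.Index → ℝ) :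
    HasScaledLaw m lam sig x X P {𝒜.base} a := by
  have hk : ouKernel m lam sig 𝒜.base 𝒜.base = 0 := by
    simp [ouKernel, hm.base_eq_zero]
  have hsum : scaledSum m lam X {𝒜.base} a = (a 𝒜.base * ·) ∘ X 𝒜.base := by
    ext ω
    simp [scaledSum, hm.base_eq_zero]
  refine ⟨by simp [hk], ?_⟩
  rw [hsum, ← Measure.map_map (by fun_prop) (h.measurable _), h.initial,
    Measure.map_dirac' (by fun_prop)]
  simp [hk, mul_comm]

lemma hasScaledLaw_of_meet_mem [IsProbabilityMeasure P] (hm : 𝒜.IsAdmissible m) (hlam : 0 < lam)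
    (h : IsSetIndexedOU m lam sig (.dirac x) X P) (S : Finset 𝒜.Index) (hbase : 𝒜.base ∈ S)
    (hmeet : ∀ U ∈ S, ∀ V ∈ S, meet U V ∈ S) (a : 𝒜.Index → ℝ) :
    HasScaledLaw m lam sig x X P S a := by
  classical
  induction S using Finset.strongInduction generalizing a with
  | H S ih =>
    obtain ⟨A, hAS, hA⟩ := S.exists_maximal ⟨_, hbase⟩
    by_cases hAb : A = 𝒜.base
    · have : S = {𝒜.base} := Finset.eq_singleton_iff_unique_mem.2 ⟨hbase, fun U hU =>
        le_antisymm (hAb ▸ hA hU (hAb ▸ base_le U)) (base_le U)⟩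
      exact this ▸ hasScaledLaw_base hm h a
    -- Removing a maximal A keeps stability: U ∩ V = A would give A ⊆ U, hence U = A.
    · have hne : ∀ U ∈ S.erase A, ∀ V ∈ S, meet U V ∈ S.erase A := fun U hU V hV => by
        obtain ⟨hUA, hUS⟩ := Finset.mem_erase.1 hU
        refine Finset.mem_erase.2 ⟨fun hUV => hUA ?_, hmeet U hUS V hV⟩
        have hAU : A ≤ U := hUV ▸ (Set.inter_subset_left : (U : Set T) ∩ V ⊆ U)
        exact le_antisymm (hA hUS hAU) hAU
      have hbase' : 𝒜.base ∈ S.erase A := Finset.mem_erase.2 ⟨Ne.symm hAb, hbase⟩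
      have hmeet' : ∀ U ∈ S.erase A, ∀ V ∈ S.erase A, meet U V ∈ S.erase A :=
        fun U hU V hV => hne U hU V (Finset.mem_of_mem_erase hV)
      rw [← Finset.insert_erase hAS]
      exact hasScaledLaw_insert hm hlam h hbase' hmeet' (Finset.notMem_erase A S)
        (fun U hU => hne U hU A hAS)
        (ih _ (Finset.erase_ssubset hAS) hbase' hmeet') a

lemma hasScaledLaw [IsProbabilityMeasure P] (hm : 𝒜.IsAdmissible m) (hlam : 0 < lam)
    (h : IsSetIndexedOU m lam sig (.dirac x) X P) (I : Finset 𝒜.Index) (a : 𝒜.Index → ℝ) :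
    HasScaledLaw m lam sig x X P I a := by
  classical
  obtain ⟨S, hIS, hbase, hmeet⟩ := exists_finset_meet_mem I
  -- The coefficients are extended by zero from `I` to an intersection-stable family.
  have hsum : ∀ f : 𝒜.Index → ℝ, ∑ U ∈ S, (if U ∈ I then a U else 0) * f U =
      ∑ U ∈ I, a U * f U := fun f => by
    simp only [ite_mul, zero_mul]
    rw [Finset.sum_ite_mem, Finset.inter_eq_right.2 hIS]
  have key := hasScaledLaw_of_meet_mem hm hlam h S hbase hmeet fun U => if U ∈ I then a U else 0
  have hfun : scaledSum m lam X S (fun U => if U ∈ I then a U else 0) = scaledSum m lam X I a :=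
    funext fun ω => hsum _
  have hone := hsum fun _ => 1
  simp only [mul_one] at hone
  simp only [HasScaledLaw, hfun, hone, mul_assoc, ← Finset.mul_sum, hsum] at key
  simpa only [HasScaledLaw, mul_assoc, ← Finset.mul_sum] using key

end IsSetIndexedOU

end IndexingCollection

end

/-! ### Gaussianity, means and covariances of the unscaled process. -/

noncomputable section

namespace IndexingCollection

variable {T : Type*} [TopologicalSpace T] {𝒜 : IndexingCollection T}
  {m : @Measure T 𝒜.sigmaField} {lam sig x : ℝ} {Ω : Type*} {X : 𝒜.Index → Ω → ℝ}

lemma IsAdmissible.toReal_symmDiff {m : @Measure T 𝒜.sigmaField} (hm : 𝒜.IsAdmissible m)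
    (U V : 𝒜.Index) : (m (symmDiff (U : Set T) V)).toReal =
      (m (U : Set T)).toReal + (m (V : Set T)).toReal - 2 * (m ((U : Set T) ∩ V)).toReal := by
  let := 𝒜.sigmaField
  have h1 := measureReal_inter_add_sdiff (μ := m) (s := (U : Set T)) (measurableSet_coe V)
    (hm.ne_top U)
  have h2 := measureReal_inter_add_sdiff (μ := m) (s := (V : Set T)) (measurableSet_coe U)
    (hm.ne_top V)
  have h3 : m.real (symmDiff (U : Set T) V) = m.real ((U : Set T) \ V) + m.real ((V : Set T) \ U) :=
    measureReal_union disjoint_sdiff_sdiff ((measurableSet_coe V).diff (measurableSet_coe U))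
      (measure_ne_top_of_subset Set.sdiff_subset (hm.ne_top U))
      (measure_ne_top_of_subset Set.sdiff_subset (hm.ne_top V))
  rw [Set.inter_comm] at h2
  simp only [measureReal_def] at h1 h2 h3
  linarith

namespace IsSetIndexedOU

variable [mΩ : MeasurableSpace Ω] {P : Measure Ω} [IsProbabilityMeasure P]

/-- The scaling is undone by taking a_U = b_U exp(-λ m(U)). -/
lemma hasLaw_sum_mul (hm : 𝒜.IsAdmissible m) (hlam : 0 < lam)
    (h : IsSetIndexedOU m lam sig (.dirac x) X P) (I : Finset 𝒜.Index) (b : 𝒜.Index → ℝ) :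
    HasLaw (fun ω => ∑ U ∈ I, b U * X U ω)
      (gaussianReal (x * ∑ U ∈ I, b U * Real.exp (-lam * (m (U : Set T)).toReal))
        (∑ U ∈ I, ∑ V ∈ I, b U * Real.exp (-lam * (m (U : Set T)).toReal) *
          (b V * Real.exp (-lam * (m (V : Set T)).toReal)) * ouKernel m lam sig U V).toNNReal) P := by
  refine ⟨(Finset.measurable_fun_sum I fun U _ => (h.measurable U).const_mul _).aemeasurable, ?_⟩
  rw [← (h.hasScaledLaw hm hlam I fun U => b U * Real.exp (-lam * (m (U : Set T)).toReal)).2]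
  congr 1
  ext ω
  refine Finset.sum_congr rfl fun U _ => ?_
  have : Real.exp (-lam * (m (U : Set T)).toReal) * Real.exp (lam * (m (U : Set T)).toReal) = 1 := by
    rw [← Real.exp_add, neg_mul, neg_add_cancel, Real.exp_zero]
  linear_combination (-(b U * X U ω)) * this

lemma variance_sum_mul (hm : 𝒜.IsAdmissible m) (hlam : 0 < lam)
    (h : IsSetIndexedOU m lam sig (.dirac x) X P) (I : Finset 𝒜.Index) (b : 𝒜.Index → ℝ) :
    variance (fun ω => ∑ U ∈ I, b U * X U ω) P =
      ∑ U ∈ I, ∑ V ∈ I, b U * Real.exp (-lam * (m (U : Set T)).toReal) *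
        (b V * Real.exp (-lam * (m (V : Set T)).toReal)) * ouKernel m lam sig U V := by
  rw [(h.hasLaw_sum_mul hm hlam I b).variance_eq, variance_id_gaussianReal,
    Real.coe_toNNReal _ (h.hasScaledLaw hm hlam I _).1]

theorem isGaussianProcess_of_isAdmissible (hm : 𝒜.IsAdmissible m) (hlam : 0 < lam)
    (h : IsSetIndexedOU m lam sig (.dirac x) X P) : IsGaussianProcess X P := by
  classical
  refine ⟨fun I => ⟨isGaussian_of_map_eq_gaussianReal fun L => ?_⟩⟩
  have hmeas : Measurable fun ω => I.restrict (X · ω) :=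
    measurable_pi_iff.2 fun U => h.measurable U
  -- Coordinates of the linear form `L`: a finite-dimensional law is Gaussian once all its linear
  -- images are.
  set b : 𝒜.Index → ℝ := fun U => if hU : U ∈ I then L (Pi.single ⟨U, hU⟩ 1) else 0 with hb
  have key : (P.map fun ω => I.restrict (X · ω)).map L =
      P.map fun ω => ∑ U ∈ I, b U * X U ω := by
    rw [Measure.map_map (by fun_prop) hmeas]
    congr 1
    ext ω
    have := L.toLinearMap.pi_apply_eq_sum_univ (I.restrict (X · ω))
    rw [Function.comp_apply, ← Finset.sum_coe_sort I]
    refine this.trans (Finset.sum_congr rfl fun U _ => ?_)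
    have hs : (fun j => if U = j then (1 : ℝ) else 0) = Pi.single U 1 := by
      ext j
      simp [Pi.single_apply, eq_comm]
    rw [hs, smul_eq_mul, mul_comm]
    simp [hb]
  exact ⟨_, _, key.trans (h.hasLaw_sum_mul hm hlam I b).map_eq⟩

theorem integral_eq (hm : 𝒜.IsAdmissible m) (hlam : 0 < lam)
    (h : IsSetIndexedOU m lam sig (.dirac x) X P) (U : 𝒜.Index) :
    ∫ ω, X U ω ∂P = x * Real.exp (-lam * (m (U : Set T)).toReal) := by
  have := (h.hasLaw_sum_mul hm hlam {U} fun _ => 1).integral_eq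
  simpa [integral_id_gaussianReal] using this

lemma variance_eq (hm : 𝒜.IsAdmissible m) (hlam : 0 < lam)
    (h : IsSetIndexedOU m lam sig (.dirac x) X P) (U : 𝒜.Index) :
    variance (X U) P = Real.exp (-lam * (m (U : Set T)).toReal) *
      Real.exp (-lam * (m (U : Set T)).toReal) * ouKernel m lam sig U U := by
  simpa using h.variance_sum_mul hm hlam {U} fun _ => 1

lemma covariance_eq_mul_ouKernel (hm : 𝒜.IsAdmissible m) (hlam : 0 < lam)
    (h : IsSetIndexedOU m lam sig (.dirac x) X P) (U V : 𝒜.Index) :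
    covariance (X U) (X V) P = Real.exp (-lam * (m (U : Set T)).toReal) *
      Real.exp (-lam * (m (V : Set T)).toReal) * ouKernel m lam sig U V := by
  classical
  by_cases hUV : U = V
  · subst hUV
    rw [covariance_self (h.measurable U).aemeasurable, h.variance_eq hm hlam]
  · have hL2 : ∀ W, MemLp (X W) 2 P := fun W =>
      ((h.isGaussianProcess_of_isAdmissible hm hlam).hasGaussianLaw_eval W).memLp_two
    -- Polarization: the covariance is read off the variance of X_U + X_V. The case U = V is
    -- separate because the pair {U, V} would collapse.
    have h1 := variance_fun_add (hL2 U) (hL2 V)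
    have h2 := h.variance_sum_mul hm hlam {U, V} fun _ => 1
    simp only [Finset.sum_pair hUV, one_mul] at h2
    rw [h2, h.variance_eq hm hlam, h.variance_eq hm hlam, ouKernel_comm V U] at h1
    linarith

theorem covariance_eq (hm : 𝒜.IsAdmissible m) (hlam : 0 < lam)
    (h : IsSetIndexedOU m lam sig (.dirac x) X P) (U V : 𝒜.Index) :
    covariance (X U) (X V) P = sig ^ 2 / (2 * lam) *
      (Real.exp (-lam * (m (symmDiff (U : Set T) (V : Set T))).toReal) -
        Real.exp (-lam * ((m (U : Set T)).toReal + (m (V : Set T)).toReal))) := by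
  rw [h.covariance_eq_mul_ouKernel hm hlam, hm.toReal_symmDiff, ouKernel, ← Real.exp_add]
  have : Real.exp (-lam * ((m (U : Set T)).toReal + (m (V : Set T)).toReal -
      2 * (m ((U : Set T) ∩ V)).toReal)) =
      Real.exp (-lam * (m (U : Set T)).toReal + -lam * (m (V : Set T)).toReal) *
        Real.exp (2 * lam * (m ((U : Set T) ∩ V)).toReal) := by
    rw [← Real.exp_add]
    congr 1
    ring
  rw [this, mul_add]
  ring

end IsSetIndexedOU

end IndexingCollection

end

theorem mainTheorem5 {T : Type*} [MetricSpace T] [LocallyCompactSpace T]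
    (𝒜 : IndexingCollection T) (m : @Measure T 𝒜.sigmaField) (hm : 𝒜.IsAdmissible m)
    (lam sig : ℝ) (hlam : 0 < lam) (hsig : 0 < sig) (x : ℝ)
    (P : Measure (𝒜.Index → ℝ)) [IsProbabilityMeasure P]
    (hP : IndexingCollection.IsSetIndexedOU m lam sig (Measure.dirac x) 𝒜.canonical P) :
    IsGaussianProcess 𝒜.canonical P ∧
    (∀ U : 𝒜.Index, ∫ ω, 𝒜.canonical U ω ∂P =
      x * Real.exp (-lam * (m (U : Set T)).toReal)) ∧
    (∀ U V : 𝒜.Index, covariance (𝒜.canonical U) (𝒜.canonical V) P =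
      sig ^ 2 / (2 * lam) *
        (Real.exp (-lam * (m (symmDiff (U : Set T) (V : Set T))).toReal) -
          Real.exp (-lam * ((m (U : Set T)).toReal + (m (V : Set T)).toReal)))) := by
  exact ⟨hP.isGaussianProcess_of_isAdmissible hm hlam,
    hP.integral_eq hm hlam, hP.covariance_eq hm hlam⟩
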